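/- Let $n\ge 1$, $s\in(0,1)$, let $\Omega\subset\mathbb R^n$ be a nonempty bounded open set, and let $\mathcal D,\mathcal N$ be disjoint open subsets of $\mathbb R^n\setminus\overline\Omega$ with $\overline{\mathcal D\cup\mathcal N}=\mathbb R^n\setminus\Omega$ and $\Omega\cup\mathcal N$ bounded. (No regularity of the boundaries is needed.) Put $$U=\Omega\cup\mathcal N\cup(\partial\Omega\cap\overline{\mathcal N}),\qquad Q=\mathbb R^{2n}\setminus(\Omega^c\times\Omega^c),$$ $$\mathcal X=\{u\in H^1(\mathbb R^n):\ u|_U\in H^1_0(U),\ u=0\text{ a.e. in }U^c\},$$ where $H^1_0(U)$ is the closure of $C_c^\infty(U)$ in $H^1(U)$, and for $u,v\in\mathcal X$ $$\langle u,v\rangle=\int_\Omega\nabla u\cdot\nabla v\,dx+\int_Q\frac{(u(x)-u(y))(v(x)-v(y))}{|x-y|^{n+2s}}\,dx\,dy,\qquad \eta(u)^2=\langle u,u\rangle .$$ A number $\lambda\in\mathbb R$ is an eigenvalue, with eigenfunction $u\in\mathcal X\setminus\{0\}$, if $\langle u,\varphi\rangle=\lambda\int_\Omega u\varphi\,dx$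 for all $\varphi\in\mathcal X$. Let $\lambda_1\le\lambda_2\le\cdots$ be real numbers and $e_1,e_2,\dots\in\mathcal X$ such that either (a) for every $k$, $\lambda_k$ is an eigenvalue and $e_k$ is an eigenfunction for $\lambda_k$; or (b) for every $k$, $e_k$ minimizes $\eta(u)^2$ among all $u\in\mathcal X$ with $\int_\Omega|u|^2\,dx=1$ and $\langle u,e_j\rangle=0$ for $j=1,\dots,k-1$, and $\lambda_k=\eta(e_k)^2$ is the minimum. (In this case the ordering of the $\lambda_k$ is automatic.) Then, for every $k\ge1$ and every $u\in\operatorname{span}\{e_1,\dots,e_k\}\setminus\{0\}$, the energy $\eta(u)^2$ is finite and $\int_\Omega|u|^2\,dx>0$, and $$\lambda_k=\max_{u\in\operatorname{span}\{e_1,\dots,e_k\}\setminus\{0\}}\ \frac{\displaystyle\int_\Omega|\nabla u(x)|^2\,dx+\int_Q\frac{|u(x)-u(y)|^2}{|x-y|^{n+2s}}\,dx\,dy}{\displaystyle\int_\Omega|u(x)|^2\,dx},$$ the maximum being attained. -/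

import Mathlib

open MeasureTheory Filter Topology Set
open scoped ContDiff ENNReal

noncomputable section

namespace MixedSpectrum

/-- Euclidean space `ℝⁿ`. -/
abbrev Rn (n : ℕ) : Type := EuclideanSpace ℝ (Fin n)

/-- Real-valued `L²(ℝⁿ)` for Lebesgue measure (functions modulo a.e. equality). -/
abbrev L2 (n : ℕ) : Type := Lp ℝ 2 (volume : Measure (Rn n))

/-- `L²(ℝⁿ; ℝⁿ)`, the space in which weak gradients live. -/
abbrev L2Vec (n : ℕ) : Type := Lp (Rn n) 2 (volume : Measure (Rn n))

/-- The geometric setting: `Ω` is a nonempty bounded open set; the Dirichlet set `D` and the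
Neumann set `N` are disjoint open subsets of `ℝⁿ ∖ closure Ω` with
`closure (D ∪ N) = ℝⁿ ∖ Ω`, and `Ω ∪ N` is bounded. -/
structure IsMixedGeometry {n : ℕ} (Ω D N : Set (Rn n)) : Prop where
  isOpen_Ω : IsOpen Ω
  nonempty_Ω : Ω.Nonempty
  bounded_Ω : Bornology.IsBounded Ω
  isOpen_D : IsOpen D
  isOpen_N : IsOpen N
  D_subset : D ⊆ (closure Ω)ᶜ
  N_subset : N ⊆ (closure Ω)ᶜ
  disjoint_DN : Disjoint D N
  closure_DN : closure (D ∪ N) = Ωᶜ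
  bounded_ΩN : Bornology.IsBounded (Ω ∪ N)

/-- `U = Ω ∪ N ∪ (∂Ω ∩ closure N)`. -/
def regionU {n : ℕ} (Ω N : Set (Rn n)) : Set (Rn n) :=
  Ω ∪ N ∪ (frontier Ω ∩ closure N)

/-- `φ ∈ C_c^∞(ℝⁿ)`. -/
def IsTestFunction {n : ℕ} (φ : Rn n → ℝ) : Prop :=
  ContDiff ℝ ∞ φ ∧ HasCompactSupport φ

/-- `g ∈ L²(ℝⁿ; ℝⁿ)` is the weak gradient of `u`: `∫ u ∇φ = - ∫ φ g` for all test functions. -/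
def IsWeakGradient {n : ℕ} (u : L2 n) (g : L2Vec n) : Prop :=
  ∀ φ : Rn n → ℝ, IsTestFunction φ →
    ∫ x, u x • gradient φ x = - ∫ x, φ x • g x

/-- `u ∈ H¹(ℝⁿ)`. -/
def MemH1 {n : ℕ} (u : L2 n) : Prop := ∃ g : L2Vec n, IsWeakGradient u g

open Classical in
/-- The weak gradient of `u` (and `0` if `u` is not in `H¹(ℝⁿ)`). -/
def weakGrad {n : ℕ} (u : L2 n) : L2Vec n :=
  if h : MemH1 u then h.choose else 0

/-- Weak gradients are unique. -/
theorem IsWeakGradient.unique {n : ℕ} {u : L2 n} {g₁ g₂ : L2Vec n}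
    (h₁ : IsWeakGradient u g₁) (h₂ : IsWeakGradient u g₂) : g₁ = g₂ := by
  apply Lp.ext
  apply ae_eq_of_integral_contDiff_smul_eq
  · exact (Lp.memLp g₁).locallyIntegrable (by norm_num)
  · exact (Lp.memLp g₂).locallyIntegrable (by norm_num)
  · intro φ h hc
    have a := h₁ φ ⟨h, hc⟩
    rw [h₂ φ ⟨h, hc⟩] at a
    exact (neg_injective a).symm

/-- `weakGrad u` is the weak gradient of `u` whenever there is one. -/
theorem IsWeakGradient.weakGrad_eq {n : ℕ} {u : L2 n} {g : L2Vec n}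
    (h : IsWeakGradient u g) : weakGrad u = g := by
  have hu : MemH1 u := ⟨g, h⟩
  rw [weakGrad, dif_pos hu]
  exact hu.choose_spec.unique h

/-- For `u ∈ H¹(ℝⁿ)`: the restriction of `u` to `U` lies in `H¹₀(U)`, the closure of `C_c^∞(U)`
in the norm of `H¹(U)`. -/
def RestrictMemH10 {n : ℕ} (U : Set (Rn n)) (u : L2 n) : Prop :=
  ∃ φ : ℕ → Rn n → ℝ,
    (∀ j, IsTestFunction (φ j) ∧ tsupport (φ j) ⊆ U) ∧
    Tendsto (fun j => eLpNorm (fun x => φ j x - u x) 2 (volume.restrict U)) atTop (𝓝 0) ∧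
    Tendsto (fun j => eLpNorm (fun x => gradient (φ j) x - weakGrad u x) 2
      (volume.restrict U)) atTop (𝓝 0)

/-- The space `X = {u ∈ H¹(ℝⁿ) : u|_U ∈ H¹₀(U), u = 0 a.e. in Uᶜ}`. -/
def spaceX {n : ℕ} (Ω N : Set (Rn n)) : Set (L2 n) :=
  {u | MemH1 u ∧ RestrictMemH10 (regionU Ω N) u ∧
    ∀ᵐ x ∂(volume : Measure (Rn n)), x ∈ (regionU Ω N)ᶜ → u x = 0}

/-- `Q = ℝ²ⁿ ∖ (Ωᶜ × Ωᶜ)`. -/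
def setQ {n : ℕ} (Ω : Set (Rn n)) : Set (Rn n × Rn n) := (Ωᶜ ×ˢ Ωᶜ)ᶜ

/-- The inner product
`⟨u, v⟩ = ∫_Ω ∇u · ∇v dx + ∫_Q (u(x) - u(y)) (v(x) - v(y)) / |x - y|^(n + 2s) dx dy`. -/
def formX {n : ℕ} (s : ℝ) (Ω : Set (Rn n)) (u v : L2 n) : ℝ :=
  (∫ x in Ω, inner ℝ (weakGrad u x) (weakGrad v x)) +
    ∫ p in setQ Ω, (u p.1 - u p.2) * (v p.1 - v p.2) / ‖p.1 - p.2‖ ^ ((n : ℝ) + 2 * s)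

/-- The energy
`η(u)² = ∫_Ω |∇u|² dx + ∫_Q |u(x) - u(y)|² / |x - y|^(n + 2s) dx dy`. -/
def etaSq {n : ℕ} (s : ℝ) (Ω : Set (Rn n)) (u : L2 n) : ℝ :=
  (∫ x in Ω, ‖weakGrad u x‖ ^ 2) +
    ∫ p in setQ Ω, |u p.1 - u p.2| ^ 2 / ‖p.1 - p.2‖ ^ ((n : ℝ) + 2 * s)

/-- `∫_Ω |u|² dx`. -/
def massSq {n : ℕ} (Ω : Set (Rn n)) (u : L2 n) : ℝ := ∫ x in Ω, |u x| ^ 2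

/-- The Rayleigh quotient `η(u)² / ∫_Ω |u|² dx`. -/
def rayleigh {n : ℕ} (s : ℝ) (Ω : Set (Rn n)) (u : L2 n) : ℝ :=
  etaSq s Ω u / massSq Ω u

/-- All integrals in the Rayleigh quotient of `u` are finite and its denominator is not zero. (The
integrals over `Ω` are finite because `u` and `weakGrad u` are in `L²`.) -/
def RayleighDefined {n : ℕ} (s : ℝ) (Ω : Set (Rn n)) (u : L2 n) : Prop :=
  IntegrableOn (fun p : Rn n × Rn n =>
    |u p.1 - u p.2| ^ 2 / ‖p.1 - p.2‖ ^ ((n : ℝ) + 2 * s)) (setQ Ω) ∧ 0 < massSq Ω u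

/-- `u` is an eigenfunction for the eigenvalue `lam` of the mixed problem: a nonzero weak
solution `u ∈ X`. -/
structure IsEigenfunction {n : ℕ} (s : ℝ) (Ω N : Set (Rn n)) (lam : ℝ) (u : L2 n) : Prop where
  mem : u ∈ spaceX Ω N
  ne_zero : u ≠ 0
  weak_eq : ∀ φ ∈ spaceX Ω N, formX s Ω u φ = lam * ∫ x in Ω, u x * φ x

/-- `lam 0 ≤ lam 1 ≤ …` is a sequence of eigenvalues with eigenfunctions `e 0, e 1, …`
(`lam k`, `e k` stand for `λ_{k+1}`, `e_{k+1}` in the numbering that starts at `1`). -/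
structure IsEigenSequence {n : ℕ} (s : ℝ) (Ω N : Set (Rn n)) (lam : ℕ → ℝ) (e : ℕ → L2 n) :
    Prop where
  mono : Monotone lam
  eigen : ∀ k, IsEigenfunction s Ω N (lam k) (e k)

/-- The space of `u ∈ X` with `⟨u, e j⟩ = 0` for all `j < k`. -/
def spaceP {n : ℕ} (s : ℝ) (Ω N : Set (Rn n)) (e : ℕ → L2 n) (k : ℕ) : Set (L2 n) :=
  {u | u ∈ spaceX Ω N ∧ ∀ j < k, formX s Ω u (e j) = 0}

/-- `lam` and `e` arise by successive minimization: `e k` minimizes the energy among the elements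
of `spaceP s Ω N e k` with unit norm in `L²(Ω)`, and `lam k` is the minimum. -/
structure IsMinSequence {n : ℕ} (s : ℝ) (Ω N : Set (Rn n)) (lam : ℕ → ℝ) (e : ℕ → L2 n) :
    Prop where
  mem : ∀ k, e k ∈ spaceP s Ω N e k
  normalized : ∀ k, massSq Ω (e k) = 1
  value : ∀ k, lam k = etaSq s Ω (e k)
  minimal : ∀ k, ∀ u ∈ spaceP s Ω N e k, massSq Ω u = 1 → lam k ≤ etaSq s Ω u

/-- The nonzero elements of the span of `e 0, …, e k`. -/
def spanNonzero {n : ℕ} (e : ℕ → L2 n) (k : ℕ) : Set (L2 n) :=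
  (Submodule.span ℝ (e '' Set.Iic k) : Set (L2 n)) \ {0}

end MixedSpectrum

end

noncomputable section

namespace MixedSpectrum

variable {n : ℕ}

/-! Let `B` be the energy form and `M` the inner product of `L²(Ω)`. Everything rests on the
relations `B (e i) (e j) = λ_i M (e i) (e j)`. Since both forms are symmetric, `M (e i) (e j) = 0`
whenever `λ_i ≠ λ_j`. For `u = ∑ c_i e_i` this gives `λ_k M(u,u) - B(u,u) = M(w,w) ≥ 0` with `w = ∑
√(λ_k - λ_i) c_i e_i` (`form_le_mul_form_of_eigen`), and `u = e_k` gives equality. Neither linear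
independence nor orthogonality within an eigenspace is needed.

The quotient is meaningful for two reasons. Functions in `H¹(ℝⁿ)` have finite Gagliardo energy
(`MemH1.integrable_gagliardo`), because `‖u(· + z) - u‖ ≤ min (‖∇u‖ |z|) (2‖u‖)` in `L²`. And if
`M(u,u) = 0`, the inequality above forces `B(u,u) = 0`, so `u` is constant and in `L²(ℝⁿ)`, hence
zero (`MemH1.eq_zero_of_etaSq_eq_zero`).

In case (a) the relations are the weak equations tested with `e_j`. In case (b) they come from the
Euler-Lagrange equation on the constrained space, completed by symmetry and `λ_j ≠ 0`
(`IsMinSequence.formX_eq`). -/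

/-! ### Test functions, weak gradients and linearity of `H¹` and `X` -/

theorem IsTestFunction.memLp {φ : Rn n → ℝ} (hφ : IsTestFunction φ) (p : ℝ≥0∞) :
    MemLp φ p volume :=
  hφ.1.continuous.memLp_of_hasCompactSupport hφ.2

theorem IsTestFunction.continuous_gradient {φ : Rn n → ℝ} (hφ : IsTestFunction φ) :
    Continuous (gradient φ) :=
  (InnerProductSpace.toDual ℝ (Rn n)).symm.continuous.comp (hφ.1.continuous_fderiv (by simp))

theorem IsTestFunction.memLp_gradient {φ : Rn n → ℝ} (hφ : IsTestFunction φ) (p : ℝ≥0∞) :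
    MemLp (gradient φ) p volume := by
  refine hφ.continuous_gradient.memLp_of_hasCompactSupport ?_
  exact (hφ.2.fderiv (𝕜 := ℝ)).comp_left (g := (InnerProductSpace.toDual ℝ (Rn n)).symm) (map_zero _)

theorem IsTestFunction.differentiable {φ : Rn n → ℝ} (hφ : IsTestFunction φ) :
    Differentiable ℝ φ := hφ.1.differentiable (by simp)

theorem IsTestFunction.add {φ ψ : Rn n → ℝ} (hφ : IsTestFunction φ) (hψ : IsTestFunction ψ) :
    IsTestFunction (fun x => φ x + ψ x) := ⟨hφ.1.add hψ.1, hφ.2.add hψ.2⟩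

theorem IsTestFunction.const_mul {φ : Rn n → ℝ} (c : ℝ) (hφ : IsTestFunction φ) :
    IsTestFunction (fun x => c * φ x) := ⟨contDiff_const.mul hφ.1, hφ.2.mul_left⟩

theorem IsTestFunction.comp_sub {φ : Rn n → ℝ} (z : Rn n) (hφ : IsTestFunction φ) :
    IsTestFunction (fun x => φ (x - z)) := by
  refine ⟨hφ.1.comp (contDiff_id.sub contDiff_const), ?_⟩
  exact hφ.2.comp_homeomorph (Homeomorph.subRight z)

theorem gradient_add_apply {φ ψ : Rn n → ℝ} {x : Rn n} (hφ : DifferentiableAt ℝ φ x)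
    (hψ : DifferentiableAt ℝ ψ x) :
    gradient (fun x => φ x + ψ x) x = gradient φ x + gradient ψ x := by
  simp only [gradient]
  rw [fderiv_fun_add hφ hψ, map_add]

theorem gradient_const_mul_apply {φ : Rn n → ℝ} {x : Rn n} (c : ℝ)
    (hφ : DifferentiableAt ℝ φ x) :
    gradient (fun x => c * φ x) x = c • gradient φ x := by
  simp only [gradient]
  rw [fderiv_const_mul hφ, map_smulₛₗ]
  simp

theorem integrable_smul_of_memLp_two {E : Type*} [NormedAddCommGroup E] [NormedSpace ℝ E]
    {X : Type*} [MeasurableSpace X] {μ : Measure X} {f : X → ℝ} {g : X → E}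
    (hf : MemLp f 2 μ) (hg : MemLp g 2 μ) : Integrable (fun x => f x • g x) μ :=
  memLp_one_iff_integrable.1 (hg.smul hf)

theorem IsWeakGradient.add {u v : L2 n} {g h : L2Vec n} (hu : IsWeakGradient u g)
    (hv : IsWeakGradient v h) : IsWeakGradient (u + v) (g + h) := by
  intro φ hφ
  have e₁ : (∫ x, (u + v : L2 n) x • gradient φ x) =
      ∫ x, (u x • gradient φ x + v x • gradient φ x) := by
    refine integral_congr_ae ?_
    filter_upwards [Lp.coeFn_add u v] with x hx
    rw [hx, Pi.add_apply, add_smul]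
  have e₂ : (∫ x, φ x • (g + h : L2Vec n) x) = ∫ x, (φ x • g x + φ x • h x) := by
    refine integral_congr_ae ?_
    filter_upwards [Lp.coeFn_add g h] with x hx
    rw [hx, Pi.add_apply, smul_add]
  rw [e₁, e₂, integral_add (integrable_smul_of_memLp_two (Lp.memLp u) (hφ.memLp_gradient 2))
    (integrable_smul_of_memLp_two (Lp.memLp v) (hφ.memLp_gradient 2)),
    integral_add (integrable_smul_of_memLp_two (hφ.memLp 2) (Lp.memLp g))
    (integrable_smul_of_memLp_two (hφ.memLp 2) (Lp.memLp h)), hu φ hφ, hv φ hφ, neg_add]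

theorem IsWeakGradient.smul (c : ℝ) {u : L2 n} {g : L2Vec n} (hu : IsWeakGradient u g) :
    IsWeakGradient (c • u) (c • g) := by
  intro φ hφ
  have e₁ : (∫ x, (c • u : L2 n) x • gradient φ x) = ∫ x, c • (u x • gradient φ x) := by
    refine integral_congr_ae ?_
    filter_upwards [Lp.coeFn_smul c u] with x hx
    rw [hx, Pi.smul_apply, smul_assoc]
  have e₂ : (∫ x, φ x • (c • g : L2Vec n) x) = ∫ x, c • (φ x • g x) := by
    refine integral_congr_ae ?_
    filter_upwards [Lp.coeFn_smul c g] with x hx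
    rw [hx, Pi.smul_apply, smul_comm]
  rw [e₁, e₂, integral_smul, integral_smul, hu φ hφ, smul_neg]

theorem isWeakGradient_zero : IsWeakGradient (0 : L2 n) 0 := by
  intro φ hφ
  have e₁ : (∫ x, (0 : L2 n) x • gradient φ x) = 0 := by
    refine integral_eq_zero_of_ae ?_
    filter_upwards [Lp.coeFn_zero ℝ 2 (volume : Measure (Rn n))]
    simp
  have e₂ : (∫ x, φ x • (0 : L2Vec n) x) = 0 := by
    refine integral_eq_zero_of_ae ?_
    filter_upwards [Lp.coeFn_zero (Rn n) 2 (volume : Measure (Rn n))]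
    simp
  rw [e₁, e₂, neg_zero]

theorem MemH1.isWeakGradient {u : L2 n} (hu : MemH1 u) : IsWeakGradient u (weakGrad u) := by
  obtain ⟨g, hg⟩ := hu
  rwa [hg.weakGrad_eq]

/-- `H¹(ℝⁿ)` as a subspace of `L²(ℝⁿ)`. -/
def H1 (n : ℕ) : Submodule ℝ (L2 n) where
  carrier := {u | MemH1 u}
  add_mem' := fun ⟨_, hg⟩ ⟨_, hh⟩ => ⟨_, hg.add hh⟩
  zero_mem' := ⟨_, isWeakGradient_zero⟩
  smul_mem' := fun c _ ⟨_, hg⟩ => ⟨_, hg.smul c⟩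

theorem weakGrad_add {u v : L2 n} (hu : MemH1 u) (hv : MemH1 v) :
    weakGrad (u + v) = weakGrad u + weakGrad v :=
  (hu.isWeakGradient.add hv.isWeakGradient).weakGrad_eq

theorem weakGrad_smul (c : ℝ) {u : L2 n} (hu : MemH1 u) :
    weakGrad (c • u) = c • weakGrad u :=
  (hu.isWeakGradient.smul c).weakGrad_eq

theorem RestrictMemH10.add {U : Set (Rn n)} {u v : L2 n} (hu : MemH1 u) (hv : MemH1 v)
    (hu' : RestrictMemH10 U u) (hv' : RestrictMemH10 U v) : RestrictMemH10 U (u + v) := by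
  obtain ⟨φ, hφ, h1, h2⟩ := hu'
  obtain ⟨ψ, hψ, h3, h4⟩ := hv'
  refine ⟨fun j x => φ j x + ψ j x, fun j => ⟨(hφ j).1.add (hψ j).1, ?_⟩, ?_, ?_⟩
  · exact (tsupport_add (φ j) (ψ j)).trans (union_subset (hφ j).2 (hψ j).2)
  · refine tendsto_of_tendsto_of_tendsto_of_le_of_le tendsto_const_nhds
      (by simpa using h1.add h3) (fun _ => zero_le) fun j => ?_
    have e : (fun x => φ j x + ψ j x - (u + v : L2 n) x) =ᵐ[volume.restrict U]
        (fun x => φ j x - u x) + fun x => ψ j x - v x := by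
      filter_upwards [ae_restrict_of_ae (Lp.coeFn_add u v)] with x hx
      simp only [hx, Pi.add_apply]
      ring
    rw [eLpNorm_congr_ae e]
    exact eLpNorm_add_le
      (((hφ j).1.memLp 2).sub (Lp.memLp u)).aestronglyMeasurable.restrict
      (((hψ j).1.memLp 2).sub (Lp.memLp v)).aestronglyMeasurable.restrict (by norm_num)
  · refine tendsto_of_tendsto_of_tendsto_of_le_of_le tendsto_const_nhds
      (by simpa using h2.add h4) (fun _ => zero_le) fun j => ?_
    have e : (fun x => gradient (fun x => φ j x + ψ j x) x - weakGrad (u + v) x)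
        =ᵐ[volume.restrict U]
        (fun x => gradient (φ j) x - weakGrad u x) + fun x => gradient (ψ j) x - weakGrad v x := by
      rw [weakGrad_add hu hv]
      filter_upwards [ae_restrict_of_ae (Lp.coeFn_add (weakGrad u) (weakGrad v))] with x hx
      rw [hx, gradient_add_apply ((hφ j).1.differentiable x) ((hψ j).1.differentiable x)]
      simp only [Pi.add_apply]
      abel
    rw [eLpNorm_congr_ae e]
    exact eLpNorm_add_le
      (((hφ j).1.memLp_gradient 2).sub (Lp.memLp (weakGrad u))).aestronglyMeasurable.restrict
      (((hψ j).1.memLp_gradient 2).sub (Lp.memLp (weakGrad v))).aestronglyMeasurable.restrict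
      (by norm_num)

theorem RestrictMemH10.smul (c : ℝ) {U : Set (Rn n)} {u : L2 n} (hu : MemH1 u)
    (hu' : RestrictMemH10 U u) : RestrictMemH10 U (c • u) := by
  obtain ⟨φ, hφ, h1, h2⟩ := hu'
  refine ⟨fun j x => c * φ j x, fun j => ⟨(hφ j).1.const_mul c, ?_⟩, ?_, ?_⟩
  · exact (tsupport_mul_subset_right (f := fun _ => c) (g := φ j)).trans (hφ j).2
  · have e : ∀ j, (fun x => c * φ j x - (c • u : L2 n) x) =ᵐ[volume.restrict U]
        c • (fun x => φ j x - u x) := fun j => by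
      filter_upwards [ae_restrict_of_ae (Lp.coeFn_smul c u)] with x hx
      simp only [hx, Pi.smul_apply, smul_eq_mul]
      ring
    simp_rw [fun j => eLpNorm_congr_ae (p := 2) (e j), eLpNorm_const_smul]
    simpa using ENNReal.Tendsto.const_mul h1 (Or.inr enorm_ne_top)
  · have e : ∀ j, (fun x => gradient (fun x => c * φ j x) x - weakGrad (c • u) x)
        =ᵐ[volume.restrict U] c • (fun x => gradient (φ j) x - weakGrad u x) := fun j => by
      rw [weakGrad_smul c hu]
      filter_upwards [ae_restrict_of_ae (Lp.coeFn_smul c (weakGrad u))] with x hx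
      rw [hx, gradient_const_mul_apply c ((hφ j).1.differentiable x)]
      simp only [Pi.smul_apply, smul_sub]
    simp_rw [fun j => eLpNorm_congr_ae (p := 2) (e j), eLpNorm_const_smul]
    simpa using ENNReal.Tendsto.const_mul h2 (Or.inr enorm_ne_top)

/-- Linearity of `X` matters in case (b), where the variations `e k + t φ` must stay admissible. -/
theorem add_mem_spaceX {Ω N : Set (Rn n)} {u v : L2 n} (hu : u ∈ spaceX Ω N)
    (hv : v ∈ spaceX Ω N) : u + v ∈ spaceX Ω N := by
  refine ⟨(H1 n).add_mem hu.1 hv.1, hu.2.1.add hu.1 hv.1 hv.2.1, ?_⟩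
  filter_upwards [hu.2.2, hv.2.2, Lp.coeFn_add u v] with x h1 h2 h3 hx
  rw [h3, Pi.add_apply, h1 hx, h2 hx, add_zero]

theorem smul_mem_spaceX (c : ℝ) {Ω N : Set (Rn n)} {u : L2 n} (hu : u ∈ spaceX Ω N) :
    c • u ∈ spaceX Ω N := by
  refine ⟨(H1 n).smul_mem c hu.1, hu.2.1.smul c hu.1, ?_⟩
  filter_upwards [hu.2.2, Lp.coeFn_smul c u] with x h1 h3 hx
  rw [h3, Pi.smul_apply, h1 hx, smul_zero]

/-! ### Algebra of two symmetric forms -/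

/-- If `B (e i) (e j) = lam i * M (e i) (e j)` for symmetric forms `B`, `M` with `M`
positive semidefinite, then `B ≤ L * M` on the span of the `e i` with `lam i ≤ L`. -/
theorem form_le_mul_form_of_eigen {V ι : Type*} [AddCommGroup V] [Module ℝ V]
    (B M : LinearMap.BilinForm ℝ V) (hB : ∀ x y, B x y = B y x) (hM : ∀ x y, M x y = M y x)
    (hpos : ∀ x, 0 ≤ M x x) (e : ι → V) (lam : ι → ℝ)
    (h : ∀ i j, B (e i) (e j) = lam i * M (e i) (e j)) {S : Finset ι} {L : ℝ}
    (hL : ∀ i ∈ S, lam i ≤ L) (c : ι → ℝ) :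
    B (∑ i ∈ S, c i • e i) (∑ i ∈ S, c i • e i) ≤
      L * M (∑ i ∈ S, c i • e i) (∑ i ∈ S, c i • e i) := by
  -- The weights turn `M` of this vector into `L * M - B` of the original one, coefficient by
  -- coefficient.
  have key := hpos (∑ i ∈ S, (√(L - lam i) * c i) • e i)
  suffices hs : M (∑ i ∈ S, (√(L - lam i) * c i) • e i) (∑ i ∈ S, (√(L - lam i) * c i) • e i) =
      L * M (∑ i ∈ S, c i • e i) (∑ i ∈ S, c i • e i) -
      B (∑ i ∈ S, c i • e i) (∑ i ∈ S, c i • e i) by linarith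
  simp only [map_sum, LinearMap.sum_apply, map_smul, LinearMap.smul_apply, smul_eq_mul,
    Finset.mul_sum, ← Finset.sum_sub_distrib]
  refine Finset.sum_congr rfl fun j hj => Finset.sum_congr rfl fun i hi => ?_
  have h1 : (lam i - lam j) * M (e i) (e j) = 0 := by
    have := h j i
    rw [hB, hM, h i j] at this
    linarith
  rw [h i j]
  -- If `lam i = lam j`, the two square roots multiply to `L - lam i`; otherwise `M (e i) (e j) = 0`
  -- and both sides vanish.
  rcases mul_eq_zero.1 h1 with h2 | h2
  · rw [← sub_eq_zero.1 h2]
    have := Real.mul_self_sqrt (sub_nonneg.2 (hL i hi))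
    linear_combination (c i * c j * M (e i) (e j)) * this
  · rw [h2]; ring

/-- A nonnegative quadratic polynomial without constant term has no linear term. -/
theorem linear_coeff_eq_zero {a b : ℝ} (h : ∀ t : ℝ, 0 ≤ 2 * t * b + t ^ 2 * a) : b = 0 := by
  -- Without a constant term the discriminant is `4 * b ^ 2`.
  have := discrim_le_zero (a := a) (b := 2 * b) (c := 0) fun t => by linarith [h t]
  simp only [discrim] at this
  nlinarith [sq_nonneg b]

/-! ### Translation estimates in `L²` -/

theorem norm_integral_smul_le {E : Type*} [NormedAddCommGroup E] [NormedSpace ℝ E]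
    {X : Type*} [MeasurableSpace X] {μ : Measure X} {f : X → ℝ} {g : X → E}
    (hf : MemLp f 2 μ) (hg : MemLp g 2 μ) :
    ‖∫ x, f x • g x ∂μ‖ ≤ (eLpNorm f 2 μ).toReal * (eLpNorm g 2 μ).toReal := by
  rw [← ENNReal.toReal_mul, ← toReal_enorm]
  refine ENNReal.toReal_mono (ENNReal.mul_ne_top hf.2.ne hg.2.ne) ?_
  refine (enorm_integral_le_lintegral_enorm _).trans ?_
  rw [← eLpNorm_one_eq_lintegral_enorm]
  exact eLpNorm_smul_le_mul_eLpNorm hg.1 hf.1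

theorem eLpNorm_comp_sub_right {F : Type*} [NormedAddCommGroup F] {f : Rn n → F}
    (p : ℝ≥0∞) (hf : AEStronglyMeasurable f volume) (z : Rn n) :
    eLpNorm (fun x => f (x - z)) p volume = eLpNorm f p volume :=
  eLpNorm_comp_measurePreserving hf (measurePreserving_sub_right volume z)

/-- The translates of a test function, integrated against `u ∈ H¹`. -/
theorem IsWeakGradient.hasFDerivAt_integral_translate {u : L2 n} {g : L2Vec n}
    (h : IsWeakGradient u g) {φ : Rn n → ℝ} (hφ : IsTestFunction φ) (z : Rn n) :
    HasFDerivAt (fun z => ∫ x, u x * φ (x - z))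
      (innerSL ℝ (∫ x, φ (x - z) • g x)) z := by
  -- Reflecting `φ` makes the integral a convolution, which can be differentiated on its smooth
  -- factor.
  set ψ : Rn n → ℝ := fun y => φ (-y) with hψ
  have hψc : HasCompactSupport ψ := hφ.2.comp_homeomorph (Homeomorph.neg (Rn n))
  have hψd : ContDiff ℝ 1 ψ := (hφ.1.of_le (by simp)).comp contDiff_neg
  have hu : LocallyIntegrable u volume := (Lp.memLp u).locallyIntegrable (by norm_num)
  have key := hψc.hasFDerivAt_convolution_right (ContinuousLinearMap.mul ℝ ℝ) (μ := volume)
    hu hψd z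
  have e₁ : convolution u ψ (ContinuousLinearMap.mul ℝ ℝ) volume =
      fun z => ∫ x, u x * φ (x - z) := by
    ext z
    simp [convolution, hψ]
  rw [e₁] at key
  refine key.congr_fderiv (Eq.symm ?_)
  have hz := hφ.comp_sub z
  have hint := integrable_smul_of_memLp_two (Lp.memLp u) (hz.memLp_gradient 2)
  -- The derivative falls on `φ` with a minus sign; the weak gradient identity for the translated
  -- `φ` moves it to `g`.
  have e₂ := h _ hz
  rw [← neg_eq_iff_eq_neg] at e₂
  rw [← e₂, map_neg, ← ContinuousLinearMap.integral_comp_comm _ hint, ← integral_neg]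
  refine integral_congr_ae (.of_forall fun x => ?_)
  ext v
  have h1 : fderiv ℝ ψ (z - x) v = - fderiv ℝ φ (x - z) v := by
    have : HasFDerivAt ψ ((fderiv ℝ φ (-(z - x))).comp (-ContinuousLinearMap.id ℝ (Rn n)))
        (z - x) :=
      (hφ.differentiable _).hasFDerivAt.comp _ (hasFDerivAt_id _).neg
    rw [this.fderiv]
    simp
  have h2 : innerSL ℝ (gradient (fun x => φ (x - z)) x) v = fderiv ℝ φ (x - z) v := by
    rw [innerSL_apply_apply, gradient, InnerProductSpace.toDual_symm_apply, fderiv_comp_sub]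
  simp [ContinuousLinearMap.precompR, h1, h2]

/-- Mean value inequality: by Cauchy-Schwarz the derivative in `z` is bounded by `‖φ‖ * ‖g‖`,
uniformly in `z` since translations preserve the `L²` norm. -/
theorem IsWeakGradient.abs_integral_translate_sub_le {u : L2 n} {g : L2Vec n}
    (h : IsWeakGradient u g) {φ : Rn n → ℝ} (hφ : IsTestFunction φ) (z : Rn n) :
    |(∫ x, u x * φ (x - z)) - ∫ x, u x * φ x| ≤ ‖g‖ * ‖z‖ * (eLpNorm φ 2 volume).toReal := by
  have := convex_univ.norm_image_sub_le_of_norm_hasFDerivWithin_le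
    (C := (eLpNorm φ 2 volume).toReal * ‖g‖) (x := (0 : Rn n)) (y := z)
    (fun y _ => (h.hasFDerivAt_integral_translate hφ y).hasFDerivWithinAt) (fun y _ => by
      rw [innerSL_apply_norm]
      refine (norm_integral_smul_le ((hφ.comp_sub y).memLp 2) (Lp.memLp g)).trans ?_
      rw [eLpNorm_comp_sub_right 2 (hφ.memLp 2).1, ← Lp.norm_def]) (mem_univ _) (mem_univ _)
  simp only [sub_zero, Real.norm_eq_abs] at this
  linarith

theorem memLp_comp_add_right (u : L2 n) (z : Rn n) :
    MemLp (fun x => u (x + z)) 2 volume :=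
  (Lp.memLp u).comp_measurePreserving (measurePreserving_add_right volume z)

/-- Duality: test functions are dense in `L²`, so the bound extends to `w` itself and reads `‖w‖ ^ 2
≤ C * ‖w‖`. -/
theorem norm_le_of_forall_test {w : L2 n} {C : ℝ} (hC : 0 ≤ C)
    (h : ∀ φ : Rn n → ℝ, IsTestFunction φ →
      |∫ x, w x * φ x| ≤ C * (eLpNorm φ 2 volume).toReal) : ‖w‖ ≤ C := by
  have key : ∀ f : L2 n, inner ℝ w f ≤ C * ‖f‖ := by
    intro f
    have hcl : IsClosed {f : L2 n | inner ℝ w f ≤ C * ‖f‖} :=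
      isClosed_le (by fun_prop) (by fun_prop)
    refine hcl.closure_subset_iff.2 ?_
      (Lp.dense_hasCompactSupport_contDiff (F := ℝ) (μ := (volume : Measure (Rn n))) (p := 2)
        (by norm_num) f)
    rintro f ⟨φ, hf, h1, h2⟩
    simp only [mem_ofPred_eq, L2.inner_def, Lp.norm_def]
    rw [eLpNorm_congr_ae hf]
    refine le_trans (le_abs_self _) (le_trans (le_of_eq ?_) (h φ ⟨h2, h1⟩))
    congr 1
    refine integral_congr_ae ?_
    filter_upwards [hf] with x hx
    simp [hx, mul_comm]
  have h1 := key w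
  rw [real_inner_self_eq_norm_sq] at h1
  rcases (norm_nonneg w).eq_or_lt with h0 | h0
  · rwa [← h0]
  · nlinarith

/-- A change of variables moves the translation from `u` to the test function, and duality applies.
This bound serves for small `z`. -/
theorem integral_translate_sub_sq_le_mul {u : L2 n} (hu : MemH1 u) (z : Rn n) :
    ∫ x, |u x - u (x + z)| ^ 2 ≤ ‖weakGrad u‖ ^ 2 * ‖z‖ ^ 2 := by
  have hm := (Lp.memLp u).sub (memLp_comp_add_right u z)
  have e : ∫ x, |u x - u (x + z)| ^ 2 = ‖hm.toLp‖ ^ 2 := by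
    rw [← real_inner_self_eq_norm_sq, L2.inner_def]
    refine integral_congr_ae ?_
    filter_upwards [hm.coeFn_toLp] with x hx
    simp [hx, sq]
  rw [e, ← mul_pow]
  refine pow_le_pow_left₀ (norm_nonneg _) (norm_le_of_forall_test (by positivity) fun φ hφ => ?_) 2
  refine le_trans (le_of_eq ?_) (hu.isWeakGradient.abs_integral_translate_sub_le hφ z)
  have i1 := integrable_smul_of_memLp_two (Lp.memLp u) (hφ.memLp 2)
  have i2 := integrable_smul_of_memLp_two (memLp_comp_add_right u z) (hφ.memLp 2)
  have e₁ : ∫ x, (hm.toLp : L2 n) x * φ x = (∫ x, u x * φ x) - ∫ x, u (x + z) * φ x := by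
    simp only [smul_eq_mul] at i1 i2
    rw [← integral_sub i1 i2]
    refine integral_congr_ae ?_
    filter_upwards [hm.coeFn_toLp] with x hx
    simp [hx, sub_mul]
  rw [e₁, ← integral_add_right_eq_self (fun x => u x * φ (x - z)) z, abs_sub_comm]
  simp

/-- The bound for large `z`, where the quadratic one is too weak. -/
theorem integral_translate_sub_sq_le (u : L2 n) (z : Rn n) :
    ∫ x, |u x - u (x + z)| ^ 2 ≤ 4 * ‖u‖ ^ 2 := by
  have h1 := (Lp.memLp u).integrable_sq
  have h2 := (memLp_comp_add_right u z).integrable_sq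
  have e : ∫ x, u x ^ 2 = ‖u‖ ^ 2 := by
    rw [← real_inner_self_eq_norm_sq, L2.inner_def]
    simp [sq]
  calc ∫ x, |u x - u (x + z)| ^ 2 ≤ ∫ x, (2 * u x ^ 2 + 2 * u (x + z) ^ 2) := by
        refine integral_mono_of_nonneg (.of_forall fun x => by positivity)
          ((h1.const_mul 2).add (h2.const_mul 2)) (.of_forall fun x => ?_)
        simp only [sq_abs]
        nlinarith [sq_nonneg (u x + u (x + z))]
    _ = 4 * ‖u‖ ^ 2 := by
        rw [integral_add (h1.const_mul 2) (h2.const_mul 2), integral_const_mul,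
          integral_const_mul, integral_add_right_eq_self (fun x => u x ^ 2) z, e]
        ring

/-! ### Finiteness of the Gagliardo energy -/

/-- In polar coordinates the integrand is at most `A r^(1 - 2s)` near `0`, integrable as `s < 1`,
and `C r^(-1 - 2s)` at infinity, integrable as `s > 0`. -/
theorem integrable_min_div_rpow_norm (hn : 1 ≤ n) {s : ℝ} (hs₀ : 0 < s) (hs₁ : s < 1)
    {A C : ℝ} (hA : 0 ≤ A) (hC : 0 ≤ C) :
    Integrable (fun z : Rn n => min (A * ‖z‖ ^ 2) C / ‖z‖ ^ ((n : ℝ) + 2 * s)) volume := by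
  have : Nonempty (Fin n) := ⟨⟨0, hn⟩⟩
  rw [integrable_fun_norm_addHaar volume (f := fun r => min (A * r ^ 2) C / r ^ ((n : ℝ) + 2 * s)),
    finrank_euclideanSpace_fin, ← Ioc_union_Ioi_eq_Ioi zero_le_one]
  have hmeas : Measurable
      (fun y : ℝ => y ^ (n - 1) • (min (A * y ^ 2) C / y ^ ((n : ℝ) + 2 * s))) := by
    fun_prop
  have e : ∀ y : ℝ, 0 < y → ∀ m : ℕ,
      y ^ (n - 1) * y ^ m / y ^ ((n : ℝ) + 2 * s) = y ^ ((m : ℝ) - 1 - 2 * s) := by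
    intro y hy m
    rw [← pow_add, ← Real.rpow_natCast, ← Real.rpow_sub hy]
    congr 1
    push_cast [Nat.cast_sub hn]
    ring
  refine IntegrableOn.union ?_ ?_
  · have hi : IntegrableOn (fun y : ℝ => A * y ^ (((2 : ℕ) : ℝ) - 1 - 2 * s)) (Ioc 0 1) := by
      refine Integrable.const_mul ?_ A
      rw [← IntegrableOn, ← intervalIntegrable_iff_integrableOn_Ioc_of_le zero_le_one]
      exact intervalIntegral.intervalIntegrable_rpow' (by push_cast; linarith)
    refine hi.mono' hmeas.aestronglyMeasurable ?_
    filter_upwards [ae_restrict_mem measurableSet_Ioc] with y hy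
    have hy0 : 0 < y := hy.1
    have hp : 0 < y ^ ((n : ℝ) + 2 * s) := Real.rpow_pos_of_pos hy0 _
    rw [Real.norm_of_nonneg (by positivity), ← e y hy0 2, smul_eq_mul]
    calc y ^ (n - 1) * (min (A * y ^ 2) C / y ^ ((n : ℝ) + 2 * s))
        ≤ y ^ (n - 1) * ((A * y ^ 2) / y ^ ((n : ℝ) + 2 * s)) := by
          gcongr; exact min_le_left _ _
      _ = _ := by ring
  · have hi : IntegrableOn (fun y : ℝ => C * y ^ (((0 : ℕ) : ℝ) - 1 - 2 * s)) (Ioi 1) :=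
      (integrableOn_Ioi_rpow_of_lt (by push_cast; linarith) zero_lt_one).const_mul C
    refine hi.mono' hmeas.aestronglyMeasurable ?_
    filter_upwards [ae_restrict_mem measurableSet_Ioi] with y hy
    have hy0 : 0 < y := zero_lt_one.trans hy
    have hp : 0 < y ^ ((n : ℝ) + 2 * s) := Real.rpow_pos_of_pos hy0 _
    rw [Real.norm_of_nonneg (by positivity), ← e y hy0 0, smul_eq_mul]
    calc y ^ (n - 1) * (min (A * y ^ 2) C / y ^ ((n : ℝ) + 2 * s))
        ≤ y ^ (n - 1) * (C / y ^ ((n : ℝ) + 2 * s)) := by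
          gcongr; exact min_le_right _ _
      _ = _ := by ring

/-- The Gagliardo energy of order `s ∈ (0, 1)` of a function in `H¹(ℝⁿ)` is finite. -/
theorem MemH1.integrable_gagliardo (hn : 1 ≤ n) {s : ℝ} (hs₀ : 0 < s) (hs₁ : s < 1)
    {u : L2 n} (hu : MemH1 u) :
    Integrable (fun p : Rn n × Rn n =>
      |u p.1 - u p.2| ^ 2 / ‖p.1 - p.2‖ ^ ((n : ℝ) + 2 * s)) volume := by
  have hum : Measurable u := (Lp.stronglyMeasurable u).measurable
  have hm : Measurable (fun p : Rn n × Rn n =>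
      |u p.1 - u p.2| ^ 2 / ‖p.1 - p.2‖ ^ ((n : ℝ) + 2 * s)) := by
    fun_prop
  have hm' : Measurable (fun p : Rn n × Rn n =>
      |u p.1 - u (p.1 + p.2)| ^ 2 / ‖p.2‖ ^ ((n : ℝ) + 2 * s)) := by
    fun_prop
  -- The shear `(x, z) ↦ (x, x + z)` preserves the measure and makes the kernel depend on `z` alone;
  -- then `x` is integrated first, for fixed `z`.
  have hmp := measurePreserving_prod_add (volume : Measure (Rn n)) (volume : Measure (Rn n))
  rw [Measure.volume_eq_prod, ← hmp.integrable_comp hm.aestronglyMeasurable]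
  have e : ((fun p : Rn n × Rn n => |u p.1 - u p.2| ^ 2 / ‖p.1 - p.2‖ ^ ((n : ℝ) + 2 * s)) ∘
      fun z : Rn n × Rn n => (z.1, z.1 + z.2)) =
      fun p : Rn n × Rn n => |u p.1 - u (p.1 + p.2)| ^ 2 / ‖p.2‖ ^ ((n : ℝ) + 2 * s) := by
    ext p
    simp
  rw [e, integrable_prod_iff' hm'.aestronglyMeasurable]
  refine ⟨.of_forall fun z => ?_, ?_⟩
  · simpa using (((Lp.memLp u).sub (memLp_comp_add_right u z)).integrable_sq).div_const _
  · refine (integrable_min_div_rpow_norm hn hs₀ hs₁ (A := ‖weakGrad u‖ ^ 2) (C := 4 * ‖u‖ ^ 2)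
      (by positivity) (by positivity)).mono'
      hm'.norm.stronglyMeasurable.integral_prod_left'.aestronglyMeasurable
      (.of_forall fun z => ?_)
    have hp : 0 ≤ ‖z‖ ^ ((n : ℝ) + 2 * s) := by positivity
    have e₂ : ∀ x, ‖|u x - u (x + z)| ^ 2 / ‖z‖ ^ ((n : ℝ) + 2 * s)‖ =
        |u x - u (x + z)| ^ 2 / ‖z‖ ^ ((n : ℝ) + 2 * s) := fun x =>
      Real.norm_of_nonneg (by positivity)
    simp only [e₂]
    rw [integral_div, Real.norm_of_nonneg (by positivity)]
    gcongr
    exact le_min (integral_translate_sub_sq_le_mul hu z) (integral_translate_sub_sq_le u z)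

theorem MemH1.integrable_gagliardo_mul (hn : 1 ≤ n) {s : ℝ} (hs₀ : 0 < s) (hs₁ : s < 1)
    {u v : L2 n} (hu : MemH1 u) (hv : MemH1 v) :
    Integrable (fun p : Rn n × Rn n =>
      (u p.1 - u p.2) * (v p.1 - v p.2) / ‖p.1 - p.2‖ ^ ((n : ℝ) + 2 * s)) volume := by
  have hum : Measurable u := (Lp.stronglyMeasurable u).measurable
  have hvm : Measurable v := (Lp.stronglyMeasurable v).measurable
  refine ((hu.integrable_gagliardo hn hs₀ hs₁).add (hv.integrable_gagliardo hn hs₀ hs₁)).mono'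
    (Measurable.aestronglyMeasurable (by fun_prop)) (.of_forall fun p => ?_)
  have hp : 0 ≤ ‖p.1 - p.2‖ ^ ((n : ℝ) + 2 * s) := by positivity
  rw [norm_div, norm_mul, Real.norm_of_nonneg hp, Pi.add_apply, ← add_div]
  simp only [Real.norm_eq_abs]
  gcongr
  nlinarith [sq_nonneg (|u p.1 - u p.2| - |v p.1 - v p.2|), sq_nonneg (|u p.1 - u p.2|),
    sq_nonneg (|v p.1 - v p.2|)]

/-! ### The energy and mass forms -/

theorem integrable_inner_L2Vec (g h : L2Vec n) (Ω : Set (Rn n)) :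
    Integrable (fun x => inner ℝ (g x) (h x)) (volume.restrict Ω) :=
  (L2.integrable_inner g h).restrict

theorem integrable_mul_L2 (u v : L2 n) (Ω : Set (Rn n)) :
    Integrable (fun x => u x * v x) (volume.restrict Ω) :=
  (integrable_smul_of_memLp_two (Lp.memLp u) (Lp.memLp v)).restrict

theorem ae_prod_of_ae {P : Rn n → Prop} (h : ∀ᵐ x ∂(volume : Measure (Rn n)), P x) :
    ∀ᵐ p ∂(volume : Measure (Rn n × Rn n)), P p.1 ∧ P p.2 :=
  (Measure.quasiMeasurePreserving_fst.ae h).and (Measure.quasiMeasurePreserving_snd.ae h)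

theorem formX_comm (s : ℝ) (Ω : Set (Rn n)) (u v : L2 n) : formX s Ω u v = formX s Ω v u := by
  simp only [formX, real_inner_comm, mul_comm]

theorem formX_self (s : ℝ) (Ω : Set (Rn n)) (u : L2 n) : formX s Ω u u = etaSq s Ω u := by
  simp only [formX, etaSq, real_inner_self_eq_norm_sq, sq_abs, ← sq]

theorem formX_add_left (hn : 1 ≤ n) {s : ℝ} (hs₀ : 0 < s) (hs₁ : s < 1) (Ω : Set (Rn n))
    {u u' v : L2 n} (hu : MemH1 u) (hu' : MemH1 u') (hv : MemH1 v) :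
    formX s Ω (u + u') v = formX s Ω u v + formX s Ω u' v := by
  have e₁ : ∫ x in Ω, inner ℝ (weakGrad (u + u') x) (weakGrad v x) =
      ∫ x in Ω, (inner ℝ (weakGrad u x) (weakGrad v x) +
        inner ℝ (weakGrad u' x) (weakGrad v x)) := by
    refine integral_congr_ae ?_
    rw [weakGrad_add hu hu']
    filter_upwards [ae_restrict_of_ae (Lp.coeFn_add (weakGrad u) (weakGrad u'))] with x hx
    rw [hx, Pi.add_apply, inner_add_left]
  have e₂ : ∫ p in setQ Ω, ((u + u' : L2 n) p.1 - (u + u' : L2 n) p.2) * (v p.1 - v p.2) /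
        ‖p.1 - p.2‖ ^ ((n : ℝ) + 2 * s) =
      ∫ p in setQ Ω, ((u p.1 - u p.2) * (v p.1 - v p.2) / ‖p.1 - p.2‖ ^ ((n : ℝ) + 2 * s) +
        (u' p.1 - u' p.2) * (v p.1 - v p.2) / ‖p.1 - p.2‖ ^ ((n : ℝ) + 2 * s)) := by
    refine integral_congr_ae ?_
    filter_upwards [ae_restrict_of_ae (ae_prod_of_ae (Lp.coeFn_add u u'))] with p hp
    rw [hp.1, hp.2, Pi.add_apply, Pi.add_apply]
    ring
  rw [formX, e₁, e₂, integral_add (integrable_inner_L2Vec _ _ _) (integrable_inner_L2Vec _ _ _),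
    integral_add (hu.integrable_gagliardo_mul hn hs₀ hs₁ hv).restrict
    (hu'.integrable_gagliardo_mul hn hs₀ hs₁ hv).restrict, formX, formX]
  ring

theorem formX_smul_left (s : ℝ) (Ω : Set (Rn n)) (c : ℝ)
    {u : L2 n} (v : L2 n) (hu : MemH1 u) :
    formX s Ω (c • u) v = c * formX s Ω u v := by
  rw [formX, formX, mul_add, ← integral_const_mul, ← integral_const_mul]
  congr 1
  · refine integral_congr_ae ?_
    rw [weakGrad_smul c hu]
    filter_upwards [ae_restrict_of_ae (Lp.coeFn_smul c (weakGrad u))] with x hx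
    rw [hx, Pi.smul_apply, real_inner_smul_left]
  · refine integral_congr_ae ?_
    filter_upwards [ae_restrict_of_ae (ae_prod_of_ae (Lp.coeFn_smul c u))] with p hp
    rw [hp.1, hp.2, Pi.smul_apply, Pi.smul_apply, smul_eq_mul, smul_eq_mul]
    ring

/-- The energy form as a bilinear form on `H¹(ℝⁿ)`. -/
def energyForm (hn : 1 ≤ n) {s : ℝ} (hs₀ : 0 < s) (hs₁ : s < 1) (Ω : Set (Rn n)) :
    LinearMap.BilinForm ℝ (H1 n) :=
  LinearMap.mk₂ ℝ (fun u v => formX s Ω u v)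
    (fun u u' v => formX_add_left hn hs₀ hs₁ Ω u.2 u'.2 v.2)
    (fun c u v => formX_smul_left s Ω c (v : L2 n) u.2)
    (fun u v v' => by
      simp only [formX_comm s Ω (u : L2 n)]
      exact formX_add_left hn hs₀ hs₁ Ω v.2 v'.2 u.2)
    (fun c u v => by
      simp only [formX_comm s Ω (u : L2 n)]
      exact formX_smul_left s Ω c (u : L2 n) v.2)

/-- The inner product of `L²(Ω)` as a bilinear form on `H¹(ℝⁿ)`. -/
def massForm (Ω : Set (Rn n)) : LinearMap.BilinForm ℝ (H1 n) :=
  have hadd (u u' v : H1 n) : ∫ x in Ω, (u + u' : L2 n) x * (v : L2 n) x =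
      (∫ x in Ω, (u : L2 n) x * (v : L2 n) x) + ∫ x in Ω, (u' : L2 n) x * (v : L2 n) x := by
    rw [← integral_add (integrable_mul_L2 _ _ _) (integrable_mul_L2 _ _ _)]
    refine integral_congr_ae ?_
    filter_upwards [ae_restrict_of_ae (Lp.coeFn_add (u : L2 n) u')] with x hx
    rw [hx, Pi.add_apply, add_mul]
  have hsmul (c : ℝ) (u v : H1 n) : ∫ x in Ω, (c • u : L2 n) x * (v : L2 n) x =
      c * ∫ x in Ω, (u : L2 n) x * (v : L2 n) x := by
    rw [← integral_const_mul]
    refine integral_congr_ae ?_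
    filter_upwards [ae_restrict_of_ae (Lp.coeFn_smul c (u : L2 n))] with x hx
    rw [hx, Pi.smul_apply, smul_eq_mul, mul_assoc]
  LinearMap.mk₂ ℝ (fun u v => ∫ x in Ω, (u : L2 n) x * (v : L2 n) x)
    hadd hsmul
    (fun u v v' => by simp only [mul_comm ((u : L2 n) _)]; exact hadd v v' u)
    (fun c u v => by simp only [mul_comm ((u : L2 n) _)]; exact hsmul c v u)

theorem energyForm_apply (hn : 1 ≤ n) {s : ℝ} (hs₀ : 0 < s) (hs₁ : s < 1) (Ω : Set (Rn n))
    (u v : H1 n) : energyForm hn hs₀ hs₁ Ω u v = formX s Ω u v := rfl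

theorem massForm_apply (Ω : Set (Rn n)) (u v : H1 n) :
    massForm Ω u v = ∫ x in Ω, (u : L2 n) x * (v : L2 n) x := rfl

theorem massForm_self (Ω : Set (Rn n)) (u : H1 n) : massForm Ω u u = massSq Ω u := by
  simp only [massForm_apply, massSq, sq_abs, ← sq]

theorem massForm_comm (Ω : Set (Rn n)) (u v : H1 n) : massForm Ω u v = massForm Ω v u := by
  simp only [massForm_apply, mul_comm]

theorem massForm_self_nonneg (Ω : Set (Rn n)) (u : H1 n) : 0 ≤ massForm Ω u u := by
  rw [massForm_self]
  exact integral_nonneg fun x => by positivity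

theorem etaSq_nonneg (s : ℝ) (Ω : Set (Rn n)) (u : L2 n) : 0 ≤ etaSq s Ω u :=
  add_nonneg (integral_nonneg fun x => by positivity) (integral_nonneg fun p => by positivity)

theorem measurableSet_setQ {Ω : Set (Rn n)} (hΩ : IsOpen Ω) : MeasurableSet (setQ Ω) :=
  (hΩ.measurableSet.compl.prod hΩ.measurableSet.compl).compl

/-- A function of zero energy is constant, hence zero. -/
theorem MemH1.eq_zero_of_etaSq_eq_zero (hn : 1 ≤ n) {s : ℝ} (hs₀ : 0 < s) (hs₁ : s < 1)
    {Ω : Set (Rn n)} (hΩ : IsOpen Ω) (hne : Ω.Nonempty) {u : L2 n} (hu : MemH1 u)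
    (h : etaSq s Ω u = 0) : u = 0 := by
  have : Nonempty (Fin n) := ⟨⟨0, hn⟩⟩
  have h1 : ∫ p in setQ Ω, |u p.1 - u p.2| ^ 2 / ‖p.1 - p.2‖ ^ ((n : ℝ) + 2 * s) = 0 := by
    have a : 0 ≤ ∫ x in Ω, ‖weakGrad u x‖ ^ 2 := integral_nonneg fun x => by positivity
    have b : 0 ≤ ∫ p in setQ Ω, |u p.1 - u p.2| ^ 2 / ‖p.1 - p.2‖ ^ ((n : ℝ) + 2 * s) :=
      integral_nonneg fun p => by positivity
    rw [etaSq] at h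
    linarith
  rw [setIntegral_eq_zero_iff_of_nonneg_ae (.of_forall fun p => by positivity)
    (hu.integrable_gagliardo hn hs₀ hs₁).integrableOn,
    Filter.EventuallyEq, ae_restrict_iff' (measurableSet_setQ hΩ), Measure.volume_eq_prod] at h1
  -- The nonlocal term alone suffices: `Q` contains `Ω × ℝⁿ`, so `u` is compared with its values on
  -- the whole space.
  have h2 : ∀ᵐ x ∂(volume : Measure (Rn n)), x ∈ Ω →
      ∀ᵐ y ∂(volume : Measure (Rn n)), u y = u x := by
    filter_upwards [Measure.ae_ae_of_ae_prod h1] with x hx hxΩ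
    filter_upwards [hx] with y hy
    have hy' := hy fun hc => hc.1 hxΩ
    rcases eq_or_ne x y with rfl | hxy
    · rfl
    have hpos : 0 < ‖x - y‖ ^ ((n : ℝ) + 2 * s) :=
      Real.rpow_pos_of_pos (norm_pos_iff.2 (sub_ne_zero.2 hxy)) _
    simp only [Pi.zero_apply, div_eq_zero_iff, hpos.ne', or_false, sq_abs] at hy'
    linarith [pow_eq_zero_iff (two_ne_zero) |>.1 hy']
  obtain ⟨x, hxΩ, hx⟩ : ∃ x ∈ Ω, ∀ᵐ y ∂(volume : Measure (Rn n)), u y = u x := by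
    by_contra hc
    refine (hΩ.measure_pos volume hne).ne' ?_
    refine measure_mono_null (fun x hx => ?_) h2
    exact fun h' => hc ⟨x, hx, h' hx⟩
  -- A constant in `L²` vanishes because `ℝⁿ` has infinite volume, which uses `1 ≤ n`.
  have hc : MemLp (fun _ : Rn n => u x) 2 volume := (Lp.memLp u).ae_eq hx
  rw [memLp_const_iff (by norm_num) (by norm_num)] at hc
  have h0 : u x = 0 := hc.resolve_right (by simp)
  apply Lp.ext
  filter_upwards [hx, Lp.coeFn_zero ℝ 2 (volume : Measure (Rn n))] with y h3 h4
  rw [h3, h4, h0, Pi.zero_apply]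

/-! ### The maximum of the Rayleigh quotient -/

/-- The variational characterization of `lam k` on the span of functions satisfying the eigenvalue
equations tested against each other. -/
theorem isGreatest_rayleigh_of_eigen (hn : 1 ≤ n) {s : ℝ} (hs₀ : 0 < s) (hs₁ : s < 1)
    {Ω : Set (Rn n)} (hΩ : IsOpen Ω) (hne : Ω.Nonempty) {lam : ℕ → ℝ} {e : ℕ → L2 n}
    (hmono : Monotone lam) (he : ∀ k, MemH1 (e k)) (he₀ : ∀ k, e k ≠ 0)
    (h : ∀ i j, formX s Ω (e i) (e j) = lam i * ∫ x in Ω, e i x * e j x) (k : ℕ) :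
    (∀ u ∈ spanNonzero e k, RayleighDefined s Ω u) ∧
      IsGreatest (rayleigh s Ω '' spanNonzero e k) (lam k) := by
  set E : ℕ → H1 n := fun i => ⟨e i, he i⟩ with hE
  set B := energyForm hn hs₀ hs₁ Ω with hB
  set M := massForm Ω with hM
  have hBM : ∀ i j, B (E i) (E j) = lam i * M (E i) (E j) := h
  have hspan : ∀ u ∈ spanNonzero e k, ∃ c : ℕ → ℝ,
      ((∑ i ∈ Finset.Iic k, c i • E i : H1 n) : L2 n) = u := by
    intro u hu
    have := hu.1
    rw [← Finset.coe_Iic, SetLike.mem_coe,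
      Submodule.mem_span_image_finset_iff_exists_fun'] at this
    obtain ⟨c, rfl⟩ := this
    exact ⟨c, by simp [hE]⟩
  have hdef : ∀ u ∈ spanNonzero e k, RayleighDefined s Ω u := by
    intro u hu
    obtain ⟨c, rfl⟩ := hspan u hu
    set w := ∑ i ∈ Finset.Iic k, c i • E i with hw
    refine ⟨(w.2.integrable_gagliardo hn hs₀ hs₁).integrableOn, ?_⟩
    rw [← massForm_self]
    -- Zero mass would make the energy at most `lam k * 0`, hence zero, and then `w = 0`.
    refine (massForm_self_nonneg Ω w).lt_of_ne' fun h0 => hu.2 ?_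
    refine w.2.eq_zero_of_etaSq_eq_zero hn hs₀ hs₁ hΩ hne
      (le_antisymm ?_ (etaSq_nonneg s Ω w))
    have := form_le_mul_form_of_eigen B M (fun u v => formX_comm s Ω u v) (massForm_comm Ω)
      (massForm_self_nonneg Ω) E lam hBM (S := Finset.Iic k) (L := lam k)
      (fun i hi => hmono (Finset.mem_Iic.1 hi)) c
    rw [← hw, h0, mul_zero] at this
    rwa [← formX_self]
  have hek : e k ∈ spanNonzero e k :=
    ⟨Submodule.subset_span ⟨k, Set.mem_Iic.2 le_rfl, rfl⟩, he₀ k⟩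
  refine ⟨hdef, ⟨e k, hek, ?_⟩, ?_⟩
  · rw [rayleigh, div_eq_iff (hdef _ hek).2.ne', ← formX_self]
    exact (hBM k k).trans (congrArg _ (massForm_self Ω (E k)))
  · rintro _ ⟨u, hu, rfl⟩
    have hpos := (hdef u hu).2
    obtain ⟨c, rfl⟩ := hspan u hu
    rw [rayleigh, div_le_iff₀ hpos, ← formX_self, ← massForm_self]
    exact form_le_mul_form_of_eigen B M (fun u v => formX_comm s Ω u v) (massForm_comm Ω)
      (massForm_self_nonneg Ω) E lam hBM (fun i hi => hmono (Finset.mem_Iic.1 hi)) c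

/-! ### Successive minimization -/

theorem spaceP_add {s : ℝ} (hn : 1 ≤ n) (hs₀ : 0 < s) (hs₁ : s < 1) {Ω N : Set (Rn n)}
    {e : ℕ → L2 n} (he : ∀ j, MemH1 (e j)) {k : ℕ} {u v : L2 n}
    (hu : u ∈ spaceP s Ω N e k) (hv : v ∈ spaceP s Ω N e k) : u + v ∈ spaceP s Ω N e k :=
  ⟨add_mem_spaceX hu.1 hv.1, fun j hj => by
    rw [formX_add_left hn hs₀ hs₁ Ω hu.1.1 hv.1.1 (he j), hu.2 j hj, hv.2 j hj, add_zero]⟩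

theorem spaceP_smul {s : ℝ} {Ω N : Set (Rn n)} {e : ℕ → L2 n} {k : ℕ} (c : ℝ) {u : L2 n}
    (hu : u ∈ spaceP s Ω N e k) : c • u ∈ spaceP s Ω N e k :=
  ⟨smul_mem_spaceX c hu.1, fun j hj => by
    rw [formX_smul_left s Ω c (e j) hu.1.1, hu.2 j hj, mul_zero]⟩

theorem spaceP_anti {s : ℝ} {Ω N : Set (Rn n)} {e : ℕ → L2 n} :
    Antitone (spaceP s Ω N e) :=
  fun _ _ hij _ hu => ⟨hu.1, fun l hl => hu.2 l (hl.trans_le hij)⟩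

namespace IsMinSequence

variable {s : ℝ} {Ω N : Set (Rn n)} {lam : ℕ → ℝ} {e : ℕ → L2 n}

theorem memH1 (h : IsMinSequence s Ω N lam e) (k : ℕ) : MemH1 (e k) := (h.mem k).1.1

/-- `e j` also competes in every earlier problem, which has fewer constraints. -/
theorem monotone (h : IsMinSequence s Ω N lam e) : Monotone lam := fun i j hij => by
  rw [h.value j]
  exact h.minimal i _ (spaceP_anti hij (h.mem j)) (h.normalized j)

/-- By homogeneity the normalization can be dropped, so the Euler-Lagrange equation follows from
free variations, without a Lagrange multiplier. -/
theorem mul_massSq_le_etaSq (h : IsMinSequence s Ω N lam e) {k : ℕ} {u : L2 n}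
    (hu : u ∈ spaceP s Ω N e k) : lam k * massSq Ω u ≤ etaSq s Ω u := by
  have h0 : 0 ≤ massSq Ω u := integral_nonneg fun x => by positivity
  rcases h0.eq_or_lt with h0 | h0
  · rw [← h0, mul_zero]
    exact etaSq_nonneg s Ω u
  set c := (√(massSq Ω u))⁻¹ with hc
  have hcc : c ^ 2 * massSq Ω u = 1 := by
    rw [hc, inv_pow, Real.sq_sqrt h0.le, inv_mul_cancel₀ h0.ne']
  have hm : massSq Ω (c • u) = 1 := by
    rw [← hcc]
    have hu1 : MemH1 u := hu.1.1
    have := massForm_self Ω (c • (⟨u, hu1⟩ : H1 n))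
    simp only [map_smul, LinearMap.smul_apply, massForm_self, smul_eq_mul] at this
    rw [sq, mul_assoc]
    exact this.symm
  have key := h.minimal k _ (spaceP_smul c hu) hm
  rw [← formX_self, formX_smul_left s Ω c _ hu.1.1, formX_comm,
    formX_smul_left s Ω c _ hu.1.1, formX_self, ← mul_assoc, ← sq] at key
  calc lam k * massSq Ω u ≤ c ^ 2 * etaSq s Ω u * massSq Ω u := by gcongr
    _ = etaSq s Ω u := by linear_combination etaSq s Ω u * hcc

/-- The Euler-Lagrange equation of the `k`-th minimization problem. -/
theorem weak_eq (hn : 1 ≤ n) (hs₀ : 0 < s) (hs₁ : s < 1)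
    (h : IsMinSequence s Ω N lam e) {k : ℕ} {φ : L2 n} (hφ : φ ∈ spaceP s Ω N e k) :
    formX s Ω (e k) φ = lam k * ∫ x in Ω, e k x * φ x := by
  rw [← sub_eq_zero]
  set E : H1 n := ⟨e k, h.memH1 k⟩
  set F : H1 n := ⟨φ, hφ.1.1⟩
  -- Along `e k + t φ` the nonnegative quantity `etaSq - lam k * massSq` is quadratic in `t` and
  -- vanishes at `t = 0`; its linear coefficient is twice the defect of the equation.
  refine linear_coeff_eq_zero (a := etaSq s Ω φ - lam k * massSq Ω φ) fun t => ?_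
  have key := h.mul_massSq_le_etaSq (spaceP_add hn hs₀ hs₁ h.memH1 (h.mem k) (spaceP_smul t hφ))
  have e₁ := massForm_self Ω (E + t • F)
  have e₂ := formX_self s Ω (E + t • F : H1 n)
  rw [← energyForm_apply hn hs₀ hs₁] at e₂
  simp only [map_add, LinearMap.add_apply, map_smul, LinearMap.smul_apply, smul_eq_mul,
    massForm_self, massForm_comm Ω F E] at e₁
  simp only [map_add, LinearMap.add_apply, map_smul, LinearMap.smul_apply, smul_eq_mul,
    energyForm_apply, formX_self, formX_comm s Ω F E] at e₂
  change lam k * massSq Ω (E + t • F : H1 n) ≤ etaSq s Ω (E + t • F : H1 n) at key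
  rw [← e₁, ← e₂] at key
  have n₁ : massSq Ω (E : L2 n) = 1 := h.normalized k
  have n₂ : etaSq s Ω (E : L2 n) = lam k := (h.value k).symm
  rw [n₁, n₂] at key
  change 0 ≤ 2 * t * (formX s Ω E F - lam k * massForm Ω E F) +
    t ^ 2 * (etaSq s Ω F - lam k * massSq Ω F)
  linarith

/-- Zero energy would force `e k = 0`, against unit mass. This lets energy orthogonality imply
orthogonality in `L²(Ω)`. -/
theorem lam_ne_zero (hn : 1 ≤ n) (hs₀ : 0 < s) (hs₁ : s < 1) (hΩ : IsOpen Ω) (hne : Ω.Nonempty)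
    (h : IsMinSequence s Ω N lam e) (k : ℕ) : lam k ≠ 0 := fun h0 => by
  have h1 := (h.memH1 k).eq_zero_of_etaSq_eq_zero hn hs₀ hs₁ hΩ hne ((h.value k).symm.trans h0)
  have h2 := massForm_self Ω (0 : H1 n)
  rw [map_zero, Submodule.coe_zero, ← h1, h.normalized k] at h2
  simp at h2

theorem ne_zero (h : IsMinSequence s Ω N lam e) (k : ℕ) : e k ≠ 0 := fun h1 => by
  have h2 := massForm_self Ω (0 : H1 n)
  rw [map_zero, Submodule.coe_zero, ← h1, h.normalized k] at h2
  simp at h2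

/-- For `i ≤ j`, `e j` is an admissible test function in problem `i`. For `j < i` the constraint
kills the left side, and equation `j` tested with `e i` gives `0 = lam j * ∫ e j * e i`, so the
right side vanishes too. -/
theorem formX_eq (hn : 1 ≤ n) (hs₀ : 0 < s) (hs₁ : s < 1) (hΩ : IsOpen Ω) (hne : Ω.Nonempty)
    (h : IsMinSequence s Ω N lam e) (i j : ℕ) :
    formX s Ω (e i) (e j) = lam i * ∫ x in Ω, e i x * e j x := by
  rcases le_or_gt i j with hij | hij
  · exact h.weak_eq hn hs₀ hs₁ (spaceP_anti hij (h.mem j))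
  · have h1 := h.weak_eq hn hs₀ hs₁ (spaceP_anti hij.le (h.mem i))
    have h2 := (h.mem i).2 j hij
    rw [formX_comm, h2] at h1
    have h3 := (mul_eq_zero.1 h1.symm).resolve_left (h.lam_ne_zero hn hs₀ hs₁ hΩ hne j)
    simp only [mul_comm (e j _)] at h3
    rw [h2, h3, mul_zero]

end IsMinSequence

end MixedSpectrum

end

theorem mainTheorem5 (n : ℕ) (hn : 1 ≤ n) (s : ℝ) (hs₀ : 0 < s) (hs₁ : s < 1)
    (Ω D N : Set (MixedSpectrum.Rn n)) (hgeo : MixedSpectrum.IsMixedGeometry Ω D N)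
    (lam : ℕ → ℝ) (e : ℕ → MixedSpectrum.L2 n)
    (hseq : MixedSpectrum.IsEigenSequence s Ω N lam e ∨
      MixedSpectrum.IsMinSequence s Ω N lam e)
    (k : ℕ) :
    (∀ u ∈ MixedSpectrum.spanNonzero e k, MixedSpectrum.RayleighDefined s Ω u) ∧
      IsGreatest (MixedSpectrum.rayleigh s Ω '' MixedSpectrum.spanNonzero e k) (lam k) := by
  rcases hseq with h | h
  · exact MixedSpectrum.isGreatest_rayleigh_of_eigen hn hs₀ hs₁ hgeo.isOpen_Ω hgeo.nonempty_Ω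
      h.mono (fun k => (h.eigen k).mem.1) (fun k => (h.eigen k).ne_zero)
      (fun i j => (h.eigen i).weak_eq _ (h.eigen j).mem) k
  · exact MixedSpectrum.isGreatest_rayleigh_of_eigen hn hs₀ hs₁ hgeo.isOpen_Ω hgeo.nonempty_Ω
      h.monotone h.memH1 h.ne_zero (h.formX_eq hn hs₀ hs₁ hgeo.isOpen_Ω hgeo.nonempty_Ω) k
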